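/- Let $\mathbb{H}$ be the real quaternions with standard basis $(1,i,j,k)$, let $\mathbb{S}^3=\{q\in\mathbb{H} : |q|=1\}$, and for $q\in\mathbb{S}^3$ let $\mathrm{B}(q)\in SO_3(\mathbb{R})$ be the matrix, in the basis $(i,j,k)$, of the map $h\mapsto qhq^{-1}$ on the space $\mathbb{R}i\oplus\mathbb{R}j\oplus\mathbb{R}k$ of pure quaternions. Equip $\mathbb{S}^3$ with the round metric induced from $\mathbb{H}=\mathbb{R}^4$, and $SO_3(\mathbb{R})$ with the bi-invariant metric $g^8$ given by $$g^8_p(pX,pY)=-\tfrac18\,\mathrm{tr}(XY),\qquad p\in SO_3(\mathbb{R}),\ X,Y\in\mathfrak{so}_3(\mathbb{R}).$$ **Lemma.** (1) The map $\mathrm{B}:\mathbb{S}^3\to SO_3(\mathbb{R})$ is smooth. Identify the tangent space $T_1\mathbb{S}^3$ with $\mathbb{R}^3$ by $(x,y,z)\leftrightarrow xi+yj+zk$ (under the inclusion $\mathbb{S}^3\subset\mathbb{H}$, $T_1\mathbb{S}^3$ is exactly the space of pure quaternions). Then the differential $\mathrm{d}_1\mathrm{B}:\mathbb{R}^3\to\mathfrak{so}_3(\mathbb{R})$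 is $$(x,y,z)\longmapsto 2\begin{pmatrix}0&-z&y\\ z&0&-x\\ -y&x&0\end{pmatrix}.$$ (2) There is exactly one Riemannian metric on the quotient manifold $\mathbb{S}^3/\{\pm1\}$ for which the projection $\pi:\mathbb{S}^3\to\mathbb{S}^3/\{\pm1\}$ is a Riemannian submersion. For this metric, $\mathrm{B}$ induces an isometry $\overline{\mathrm{B}}:\mathbb{S}^3/\{\pm1\}\to SO_3(\mathbb{R})$, i.e. a diffeomorphism with $\overline{\mathrm{B}}\circ\pi=\mathrm{B}$ that preserves the Riemannian metrics. -/

import Mathlib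

open scoped Manifold ContDiff Quaternion Matrix
open Bundle

noncomputable section

namespace QuatRot

abbrev E3 : Type := EuclideanSpace ℝ (Fin 3)

abbrev Mat3 : Type := Matrix (Fin 3) (Fin 3) ℝ

/-! ### Riemannian metrics on 3-manifolds, Riemannian submersions, isometries -/

/-- Smooth Riemannian metrics on a 3-dimensional smooth manifold. -/
abbrev RiemMetric (M : Type*) [TopologicalSpace M] [ChartedSpace E3 M] [IsManifold (𝓡 3) ∞ M] :=
  ContMDiffRiemannianMetric (𝓡 3) ∞ E3 (fun x : M => TangentSpace (𝓡 3) x)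

section Riemannian

variable {M N : Type*} [TopologicalSpace M] [ChartedSpace E3 M] [IsManifold (𝓡 3) ∞ M]
  [TopologicalSpace N] [ChartedSpace E3 N] [IsManifold (𝓡 3) ∞ N]

/-- A smooth submersion whose differential restricts, at each point `x`, to a linear isometry
from the orthogonal complement of its kernel onto the tangent space at the image point. -/
def IsRiemannianSubmersion (g : RiemMetric M) (h : RiemMetric N) (f : M → N) : Prop :=
  ContMDiff (𝓡 3) (𝓡 3) ∞ f ∧
    ∀ x : M, Function.Surjective (mfderiv (𝓡 3) (𝓡 3) f x) ∧
      ∀ u v : TangentSpace (𝓡 3) x,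
        (∀ w, mfderiv (𝓡 3) (𝓡 3) f x w = 0 → g.inner x u w = 0) →
        (∀ w, mfderiv (𝓡 3) (𝓡 3) f x w = 0 → g.inner x v w = 0) →
          g.inner x u v =
            h.inner (f x) (mfderiv (𝓡 3) (𝓡 3) f x u) (mfderiv (𝓡 3) (𝓡 3) f x v)

/-- A diffeomorphism that preserves the Riemannian metrics. -/
def IsRiemannianIsometry (g : RiemMetric M) (h : RiemMetric N)
    (f : M ≃ₘ^∞⟮𝓡 3, 𝓡 3⟯ N) : Prop :=
  ∀ (x : M) (u v : TangentSpace (𝓡 3) x),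
    h.inner (f x) (mfderiv (𝓡 3) (𝓡 3) f x u) (mfderiv (𝓡 3) (𝓡 3) f x v) = g.inner x u v

end Riemannian

theorem isVonNBounded_of_pos (B : E3 →L[ℝ] E3 →L[ℝ] ℝ) (hB : ∀ v, v ≠ 0 → 0 < B v v) :
    Bornology.IsVonNBounded ℝ {v : E3 | B v v < 1} := by
  have hc : Continuous fun v : E3 => B v v := by fun_prop
  have hne : (Metric.sphere (0 : E3) 1).Nonempty := by
    simp
  obtain ⟨w, hw, hmin⟩ := (isCompact_sphere (0 : E3) 1).exists_isMinOn hne hc.continuousOn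
  have hw0 : w ≠ 0 := by
    rintro rfl
    simp at hw
  have hm : 0 < B w w := hB w hw0
  have key : ∀ v : E3, B w w * ‖v‖ ^ 2 ≤ B v v := by
    intro v
    rcases eq_or_ne v 0 with rfl | hv
    · simp
    have hn : ‖v‖ ≠ 0 := norm_ne_zero_iff.2 hv
    have h1 : ‖v‖⁻¹ • v ∈ Metric.sphere (0 : E3) 1 := by
      simp [norm_smul, hn]
    have h2 : B w w ≤ B (‖v‖⁻¹ • v) (‖v‖⁻¹ • v) := hmin h1
    simp only [map_smul, smul_apply, smul_eq_mul] at h2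
    have h3 : ‖v‖⁻¹ * (‖v‖⁻¹ * B v v) * ‖v‖ ^ 2 = B v v := by field_simp
    rw [← h3]
    exact mul_le_mul_of_nonneg_right h2 (by positivity)
  rw [NormedSpace.isVonNBounded_iff]
  refine (Metric.isBounded_iff_subset_closedBall 0).2 ⟨(B w w)⁻¹ + 1, fun v hv => ?_⟩
  rw [mem_closedBall_zero_iff]
  by_contra! h
  have h1 : B v v < 1 := hv
  have h2 := key v
  have h4 : 1 < ‖v‖ := by
    have := inv_pos.2 hm
    linarith
  have h3 : 1 < B w w * ‖v‖ := by
    have : B w w * (B w w)⁻¹ = 1 := mul_inv_cancel₀ hm.ne'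
    nlinarith
  nlinarith

theorem contDiff_flip {E F : Type*} [NormedAddCommGroup E] [NormedSpace ℝ E]
    [NormedAddCommGroup F] [NormedSpace ℝ F] {n : ℕ∞ω} :
    ContDiff ℝ n (fun L : E →L[ℝ] F →L[ℝ] ℝ => L.flip) :=
  IsBoundedLinearMap.contDiff ⟨⟨fun _ _ => rfl, fun _ _ => rfl⟩, 1, one_pos, fun L =>
    (L.opNorm_flip).trans_le (one_mul _).ge⟩

theorem contMDiffAt_bilinearComp {M : Type*} [TopologicalSpace M] [ChartedSpace E3 M]
    {E F : Type*} [NormedAddCommGroup E] [NormedSpace ℝ E]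
    [NormedAddCommGroup F] [NormedSpace ℝ F] {Φ : M → F →L[ℝ] F →L[ℝ] ℝ} {A : M → E →L[ℝ] F}
    {x : M} (hΦ : ContMDiffAt (𝓡 3) 𝓘(ℝ, F →L[ℝ] F →L[ℝ] ℝ) ∞ Φ x)
    (hA : ContMDiffAt (𝓡 3) 𝓘(ℝ, E →L[ℝ] F) ∞ A x) :
    ContMDiffAt (𝓡 3) 𝓘(ℝ, E →L[ℝ] E →L[ℝ] ℝ) ∞
      (fun y => (Φ y).bilinearComp (A y) (A y)) x := by
  have h3 := hΦ.clm_comp hA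
  have h4 := ((contDiff_flip (E := E) (F := F)).contMDiff.contMDiffAt.comp x h3).clm_comp hA
  exact (contDiff_flip (E := E) (F := E)).contMDiff.contMDiffAt.comp x h4

section Pullback

variable {M : Type*} [TopologicalSpace M] [ChartedSpace E3 M] [IsManifold (𝓡 3) ∞ M]
  {F : Type*} [NormedAddCommGroup F] [NormedSpace ℝ F]

theorem contMDiffAt_mvfderiv_symm (f : M → F) (hf : ContMDiff (𝓡 3) 𝓘(ℝ, F) ∞ f) (x : M) :
    ContMDiffAt (𝓡 3) 𝓘(ℝ, E3 →L[ℝ] F) ∞ (fun y => (mvfderiv (𝓡 3) f y).comp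
      ((trivializationAt E3 (TangentSpace (𝓡 3)) x).symmL ℝ y)) x := by
  have h1 := (hf x).mfderiv_const (m := ∞) (by simp)
  refine h1.congr_of_eventuallyEq (Filter.Eventually.of_forall fun y => ?_)
  ext v
  simp [inTangentCoordinates, ContinuousLinearMap.inCoordinates, mvfderiv]
  rfl

/-- The Riemannian metric `g_x(u, v) = Φ_x(df_x u, df_x v)` on `M`, for a smooth map `f` from `M`
to a vector space and smoothly varying bilinear forms `Φ_x` on that space. -/
def pullbackMetric (f : M → F) (hf : ContMDiff (𝓡 3) 𝓘(ℝ, F) ∞ f)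
    (Φ : M → F →L[ℝ] F →L[ℝ] ℝ) (hΦ : ContMDiff (𝓡 3) 𝓘(ℝ, F →L[ℝ] F →L[ℝ] ℝ) ∞ Φ)
    (hsymm : ∀ x u v, Φ x u v = Φ x v u)
    (hpos : ∀ x (v : TangentSpace (𝓡 3) x), v ≠ 0 →
      0 < Φ x (mvfderiv (𝓡 3) f x v) (mvfderiv (𝓡 3) f x v)) :
    RiemMetric M where
  inner x := (ContinuousLinearMap.precomp ℝ (mvfderiv (𝓡 3) f x)).comp
    ((Φ x).comp (mvfderiv (𝓡 3) f x))
  symm x v w := hsymm x _ _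
  pos x v hv := hpos x v hv
  isVonNBounded x := isVonNBounded_of_pos
    ((ContinuousLinearMap.precomp ℝ (mvfderiv (𝓡 3) f x)).comp
    ((Φ x).comp (mvfderiv (𝓡 3) f x))) (hpos x)
  contMDiff := by
    intro x
    rw [contMDiffAt_section]
    have h1 := contMDiffAt_mvfderiv_symm f hf x
    have h2 : ContMDiffAt (𝓡 3) 𝓘(ℝ, E3 →L[ℝ] E3 →L[ℝ] ℝ) ∞ (fun y =>
      (Φ y).bilinearComp ((mvfderiv (𝓡 3) f y).comp
      ((trivializationAt E3 (TangentSpace (𝓡 3)) x).symmL ℝ y)) ((mvfderiv (𝓡 3) f y).comp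
      ((trivializationAt E3 (TangentSpace (𝓡 3)) x).symmL ℝ y))) x :=
      contMDiffAt_bilinearComp (hΦ x) h1
    refine h2.congr_of_eventuallyEq ?_
    filter_upwards [(trivializationAt E3 (TangentSpace (𝓡 3)) x).open_baseSet.mem_nhds
      (mem_baseSet_trivializationAt E3 (TangentSpace (𝓡 3)) x)] with y hy
    ext1 v
    ext1 w
    rw [hom_trivializationAt_apply]
    refine (inCoordinates_apply_eq₂ hy hy (Set.mem_univ _)).trans ?_
    have e := fun u => Trivialization.symmL_apply (R := ℝ)
      (trivializationAt E3 (TangentSpace (𝓡 3)) x) hy u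
    simp only [Trivial.linearMapAt_trivialization, Trivial.fiberBundle_trivializationAt',
      LinearMap.id_apply]
    exact congr(Φ y (mvfderiv (𝓡 3) f y $((e v).symm)) (mvfderiv (𝓡 3) f y $((e w).symm)))
theorem pullbackMetric_inner (f : M → F) (hf Φ hΦ hsymm hpos) (x : M)
    (u v : TangentSpace (𝓡 3) x) :
    (pullbackMetric f hf Φ hΦ hsymm hpos).inner x u v =
      Φ x (mvfderiv (𝓡 3) f x u) (mvfderiv (𝓡 3) f x v) := rfl

end Pullback

/-! ### The 3-sphere of unit quaternions and its quotient by `±1` -/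

instance : Fact (Module.finrank ℝ ℍ[ℝ] = 3 + 1) := ⟨Quaternion.finrank_eq_four⟩

/-- The unit quaternions, with Mathlib's group and manifold structures on a unit sphere. -/
abbrev S3 : Type := Metric.sphere (0 : ℍ[ℝ]) 1

instance : Group S3 := Metric.unitSphere.instGroup
instance : Mul S3 := (Metric.unitSphere.instMonoid : Monoid S3).toMulOneClass.toMul
instance : HasDistribNeg S3 := Metric.sphere.instHasDistribNeg
instance : ContinuousMul S3 := Metric.sphere.instContinuousMul

/-- The subgroup `{1, -1}`. -/
def pmOne : Subgroup S3 where
  carrier := {1, -1}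
  one_mem' := by simp
  mul_mem' := by rintro _ _ (rfl | rfl) (rfl | rfl) <;> simp
  inv_mem' := by 
    rintro _ (rfl | rfl)
    · simp
    · right; rw [Set.mem_singleton_iff, inv_eq_iff_mul_eq_one]; simp

instance : Finite pmOne := Set.Finite.to_subtype (s := ({1,-1} : Set S3)) (by simp)
instance : ContinuousConstSMul pmOne S3 := ⟨fun g => continuous_const_mul g.1⟩

/-- The quotient `S³/{±1}`, with the quotient topology and the smooth structure for which the
projection is a local diffeomorphism. -/
abbrev S3modPM : Type := MulAction.orbitRel.Quotient pmOne S3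

section Quotient
variable {G : Type*} [Group G] {M : Type*} [TopologicalSpace M] [ChartedSpace E3 M]
  [MulAction G M] [ProperlyDiscontinuousSMul G M] [ContinuousConstSMul G M] [IsCancelSMul G M]
  [T2Space M] [LocallyCompactSpace M]

theorem isManifold_orbitQuotient {n : ℕ∞ω} [IsManifold (𝓡 3) n M]
    (hsm : ∀ g : G, ContMDiff (𝓡 3) (𝓡 3) n (fun x : M => g • x)) :
    IsManifold (𝓡 3) n (MulAction.orbitRel.Quotient G M) := by
  have hf : IsLocalHomeomorph (Quotient.mk (MulAction.orbitRel G M)) :=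
    isQuotientCoveringMap_quotientMk_of_properlyDiscontinuousSMul.isCoveringMap
      |>.isLocalHomeomorph
  have key : ∀ a b : M, ContDiffOn ℝ n
      (((hf.localInverseAt a).trans (chartAt E3 a)).symm ≫ₕ
        ((hf.localInverseAt b).trans (chartAt E3 b)))
      (((hf.localInverseAt a).trans (chartAt E3 a)).symm ≫ₕ
        ((hf.localInverseAt b).trans (chartAt E3 b))).source := by
    intro a b z hz
    simp only [OpenPartialHomeomorph.trans_symm_eq_symm_trans_symm,
      OpenPartialHomeomorph.trans_source, OpenPartialHomeomorph.coe_trans,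
      OpenPartialHomeomorph.symm_source, hf.localInverseAt_symm, Set.mem_inter_iff,
      Set.mem_preimage, Function.comp_apply] at hz
    obtain ⟨⟨hz1, hz2⟩, hz3, hz4⟩ := hz
    set s := hf.localInverseAt b with hs
    set m : M := (chartAt E3 a).symm z with hm
    set m' : M := s (Quotient.mk _ m) with hm'
    have hmm' : Quotient.mk (MulAction.orbitRel G M) m' = Quotient.mk _ m :=
      hf.apply_localInverseAt_of_mem hz3
    obtain ⟨g, hg⟩ : ∃ g : G, g • m = m' := by
      have := Quotient.exact hmm'
      exact this
    have hfg : ∀ y : M, Quotient.mk (MulAction.orbitRel G M) (g • y) = Quotient.mk _ y :=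
      fun y => Quotient.sound (MulAction.mem_orbit y g)
    have hm't : m' ∈ s.target := s.map_source hz3
    have hnear : ∀ᶠ y in nhds m, s (Quotient.mk _ y) = g • y := by
      have h1 : ∀ᶠ y in nhds m, g • y ∈ s.target :=
        (continuous_const_smul g).continuousAt.preimage_mem_nhds
          (s.open_target.mem_nhds (by rw [hg]; exact hm't))
      have h2 : ∀ᶠ y in nhds m, Quotient.mk (MulAction.orbitRel G M) y ∈ s.source :=
        hf.continuous.continuousAt.preimage_mem_nhds (s.open_source.mem_nhds hz3)
      filter_upwards [h1, h2] with y hy1 hy2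
      refine hf.injOn_localInverseAt_target (s.map_source hy2) hy1 ?_
      rw [hfg, hf.apply_localInverseAt_of_mem hy2]
    have hca : ContMDiffAt (𝓡 3) (𝓡 3) n (chartAt E3 a).symm z :=
      (contMDiffOn_chart_symm (x := a)).contMDiffAt ((chartAt E3 a).open_target.mem_nhds hz1)
    have hcb : ContMDiffAt (𝓡 3) (𝓡 3) n (chartAt E3 b) (g • m) :=
      (contMDiffOn_chart (x := b)).contMDiffAt
        ((chartAt E3 b).open_source.mem_nhds (by rw [hg]; exact hz4))
    have hc := (hcb.comp m ((hsm g) m)).comp z hca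
    have hc' : ContMDiffAt (𝓡 3) (𝓡 3) n (((hf.localInverseAt a).trans (chartAt E3 a)).symm ≫ₕ
        ((hf.localInverseAt b).trans (chartAt E3 b))) z := by
      refine hc.congr_of_eventuallyEq ?_
      filter_upwards [hca.continuousAt.eventually hnear] with y hy
      simp only [OpenPartialHomeomorph.trans_symm_eq_symm_trans_symm,
        OpenPartialHomeomorph.coe_trans, hf.localInverseAt_symm, Function.comp_apply, ← hs, hy]
      rfl
    exact (contMDiffAt_iff_contDiffAt.1 hc').contDiffWithinAt
  refine isManifold_of_contDiffOn (𝓡 3) n _ ?_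
  rintro _ _ ⟨a, rfl⟩ ⟨b, rfl⟩
  simpa using key _ _

end Quotient

theorem contMDiff_pmOne_smul {n : ℕ∞ω} (g : pmOne) :
    ContMDiff (𝓡 3) (𝓡 3) n (fun x : S3 => g • x) := by
  obtain ⟨g, rfl | rfl⟩ := g
  · exact contMDiff_id.congr fun x => one_mul x
  · exact contMDiff_neg_sphere.congr fun x => neg_one_mul x

instance {n : ℕ∞ω} : IsManifold (𝓡 3) n S3modPM := isManifold_orbitQuotient contMDiff_pmOne_smul

/-- The projection `S³ → S³/{±1}`. -/
def proj (q : S3) : S3modPM := Quotient.mk _ q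

/-- The differential of the inclusion `S³ ⊂ ℍ`, which views a tangent vector as a quaternion. -/
def tangentQuat (q : S3) (v : TangentSpace (𝓡 3) q) : ℍ[ℝ] :=
  mvfderiv (𝓡 3) (Subtype.val : S3 → ℍ[ℝ]) q v

/-- The round metric on `S³`, induced by the Euclidean inner product of `ℍ = ℝ⁴`. -/
def roundMetric : RiemMetric S3 :=
  pullbackMetric (Subtype.val : S3 → ℍ[ℝ]) contMDiff_coe_sphere (fun _ => innerSL ℝ)
    contMDiff_const (fun _ u v => real_inner_comm (F := ℍ[ℝ]) v u) (fun x v hv => by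
      refine (real_inner_self_pos (F := ℍ[ℝ])).2 fun h => hv ?_
      exact injective_mvfderiv_subtypeVal_sphere x (h.trans (map_zero _).symm))

theorem roundMetric_inner (q : S3) (u v : TangentSpace (𝓡 3) q) :
    roundMetric.inner q u v = inner ℝ (tangentQuat q u) (tangentQuat q v) := rfl

/-! ### The Lie group `SO₃(ℝ)` as a smooth submanifold of `M₃(ℝ)` -/

section SO3

attribute [local instance] Matrix.normedAddCommGroup Matrix.normedSpace

/-- The group of orthogonal real 3×3 matrices of determinant 1. -/
abbrev SO3 : Type := Matrix.specialOrthogonalGroup (Fin 3) ℝ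

theorem so3_eqs (R : SO3) : (R.1 * R.1ᵀ = 1) ∧ R.1ᵀ * R.1 = 1 ∧ R.1.det = 1 := by
  obtain ⟨R, hR⟩ := R
  rw [Matrix.mem_specialOrthogonalGroup_iff, Matrix.mem_orthogonalGroup_iff] at hR
  refine ⟨hR.1, ?_, hR.2⟩
  exact mul_eq_one_comm.1 hR.1

theorem so3_inv_coe (R : SO3) : ((R⁻¹ : SO3) : Mat3) = (R.1)ᵀ := rfl


/-- The rotation matrix of the quaternion `1 + x₀ i + x₁ j + x₂ k`, rescaled to norm one. -/
def cayMat (x : EuclideanSpace ℝ (Fin 3)) : Mat3 :=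
  (1 + x 0 ^ 2 + x 1 ^ 2 + x 2 ^ 2)⁻¹ •
  !![1 + x 0 ^ 2 - x 1 ^ 2 - x 2 ^ 2, 2 * (x 0 * x 1 - x 2), 2 * (x 0 * x 2 + x 1);
     2 * (x 0 * x 1 + x 2), 1 - x 0 ^ 2 + x 1 ^ 2 - x 2 ^ 2, 2 * (x 1 * x 2 - x 0);
     2 * (x 0 * x 2 - x 1), 2 * (x 1 * x 2 + x 0), 1 - x 0 ^ 2 - x 1 ^ 2 + x 2 ^ 2]

theorem cayMat_den (x : EuclideanSpace ℝ (Fin 3)) : 1 + x 0 ^ 2 + x 1 ^ 2 + x 2 ^ 2 ≠ 0 := by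
  positivity

theorem cayMat_mem (x : EuclideanSpace ℝ (Fin 3)) : cayMat x ∈ Matrix.specialOrthogonalGroup (Fin 3) ℝ := by
  rw [Matrix.mem_specialOrthogonalGroup_iff, Matrix.mem_orthogonalGroup_iff]
  have h := cayMat_den x
  constructor
  · change cayMat x * (cayMat x)ᵀ = 1
    ext i j
    fin_cases i <;> fin_cases j <;>
      simp [cayMat, Matrix.mul_apply, Fin.sum_univ_three] <;> field_simp <;> ring
  · rw [cayMat, Matrix.det_smul, Matrix.det_fin_three]
    simp; field_simp; ring

/-- The inverse of `cayMat`, where the trace is not `-1`. -/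
def cayInv (R : Mat3) : EuclideanSpace ℝ (Fin 3) :=
  (1 + R.trace)⁻¹ • !₂[R 2 1 - R 1 2, R 0 2 - R 2 0, R 1 0 - R 0 1]

theorem cayInv_cayMat (x : EuclideanSpace ℝ (Fin 3)) : cayInv (cayMat x) = x := by
  have h := cayMat_den x
  have ht : 1 + (cayMat x).trace = 4 * (1 + x 0 ^ 2 + x 1 ^ 2 + x 2 ^ 2)⁻¹ := by
    simp [cayMat, Matrix.trace_fin_three]; field_simp; ring
  ext i
  rw [cayInv, ht]
  fin_cases i <;> simp [cayMat] <;> field_simp <;> ring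

theorem cayMat_trace (x : EuclideanSpace ℝ (Fin 3)) : 1 + (cayMat x).trace ≠ 0 := by
  have h := cayMat_den x
  have ht : 1 + (cayMat x).trace = 4 * (1 + x 0 ^ 2 + x 1 ^ 2 + x 2 ^ 2)⁻¹ := by
    simp [cayMat, Matrix.trace_fin_three]; field_simp; ring
  rw [ht]; positivity

theorem cayMat_cayInv (R : SO3) (hR : 1 + R.1.trace ≠ 0) : cayMat (cayInv R.1) = R.1 := by
  obtain ⟨h1, h2, h3⟩ := so3_eqs R
  have hadj : R.1.adjugate = R.1ᵀ := by
    calc R.1.adjugate = R.1ᵀ * (R.1 * R.1.adjugate) := by rw [← mul_assoc, h2, one_mul]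
      _ = R.1ᵀ := by rw [Matrix.mul_adjugate, h3]; simp
  generalize R.1 = Q at *
  have e1 := fun i j => congrFun (congrFun h1 i) j
  have e2 := fun i j => congrFun (congrFun h2 i) j
  have e3 := fun i j => congrFun (congrFun hadj i) j
  simp [Fin.forall_fin_succ, Matrix.mul_apply, Fin.sum_univ_three, Matrix.adjugate_fin_three] at e1 e2 e3
  obtain ⟨⟨a1, a2, a3⟩, ⟨a4, a5, a6⟩, a7, a8, a9⟩ := e1
  obtain ⟨⟨b1, b2, b3⟩, ⟨b4, b5, b6⟩, b7, b8, b9⟩ := e2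
  obtain ⟨⟨c1, c2, c3⟩, ⟨c4, c5, c6⟩, c7, c8, c9⟩ := e3
  obtain ⟨s, hs⟩ : ∃ s, s = 1 + Q.trace := ⟨_, rfl⟩
  have hs' : s = 1 + (Q 0 0 + Q 1 1 + Q 2 2) := by rw [hs, Matrix.trace_fin_three]
  rw [← hs] at hR
  have hx : ∀ k, cayInv Q k =
      ![Q 2 1 - Q 1 2, Q 0 2 - Q 2 0, Q 1 0 - Q 0 1] k / s := by
    intro k
    fin_cases k <;> simp [cayInv, ← hs, div_eq_inv_mul]
  have hden : 1 + cayInv Q 0 ^ 2 + cayInv Q 1 ^ 2 + cayInv Q 2 ^ 2 = 4 / s := by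
    simp only [hx]
    simp
    field_simp
    rw [hs']
    linarith
  ext i j
  rw [cayMat, hden]
  simp only [hx]
  fin_cases i <;> fin_cases j <;> simp <;> field_simp <;> rw [hs'] <;> linarith

theorem contDiff_cayMat {n : ℕ∞ω} : ContDiff ℝ n cayMat := by
  refine contDiff_pi.2 fun i => contDiff_pi.2 fun j => ?_
  have hc : ∀ k : Fin 3, ContDiff ℝ n (fun x : E3 => x k) := fun k => by fun_prop
  have hd : ContDiff ℝ n (fun x : E3 => (1 + x 0 ^ 2 + x 1 ^ 2 + x 2 ^ 2)⁻¹) :=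
    ContDiff.inv (by fun_prop) cayMat_den
  have h0 := hc 0
  have h1 := hc 1
  have h2 := hc 2
  fin_cases i <;> fin_cases j <;> simp only [cayMat] <;> simp <;> fun_prop

theorem contDiffOn_cayInv {n : ℕ∞ω} :
    ContDiffOn ℝ n cayInv {R : Mat3 | 1 + R.trace ≠ 0} := by
  have hc : ∀ i j : Fin 3, ContDiff ℝ n (fun R : Mat3 => R i j) := fun i j =>
    contDiff_pi.1 (contDiff_pi.1 contDiff_id i) j
  have ht : ContDiff ℝ n (fun R : Mat3 => 1 + R.trace) := by
    simp only [Matrix.trace_fin_three]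
    exact contDiff_const.add (((hc 0 0).add (hc 1 1)).add (hc 2 2))
  refine ContDiffOn.smul (ht.contDiffOn.inv fun R hR => hR) (ContDiff.contDiffOn ?_)
  rw [contDiff_euclidean]
  intro k
  fin_cases k <;> simp <;> exact (hc _ _).sub (hc _ _)

theorem contDiff_mulMat {n : ℕ∞ω} (P : Mat3) : ContDiff ℝ n (fun R : Mat3 => P * R) :=
  (LinearMap.toContinuousLinearMap (LinearMap.mulLeft ℝ P)).contDiff

/-- The chart of `SO₃(ℝ)` around `1`, with inverse `cayMat`. -/
def SO3.baseChart : OpenPartialHomeomorph SO3 E3 where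
  toFun R := cayInv R.1
  invFun x := ⟨cayMat x, cayMat_mem x⟩
  source := {R | 1 + R.1.trace ≠ 0}
  target := Set.univ
  map_source' _ _ := Set.mem_univ _
  map_target' x _ := cayMat_trace x
  left_inv' R hR := Subtype.ext (cayMat_cayInv R hR)
  right_inv' x _ := cayInv_cayMat x
  open_source := isOpen_ne_fun
    (continuous_const.add (continuous_subtype_val.matrix_trace)) continuous_const
  open_target := isOpen_univ
  continuousOn_toFun := (contDiffOn_cayInv (n := 0)).continuousOn.comp
    continuous_subtype_val.continuousOn fun _ h => h
  continuousOn_invFun :=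
    (Continuous.subtype_mk (contDiff_cayMat (n := 0)).continuous _).continuousOn

/-- The left translate of the chart around `1` to a chart around `P`. -/
def SO3.chart (P : SO3) : OpenPartialHomeomorph SO3 E3 :=
  (Homeomorph.mulLeft P⁻¹).toOpenPartialHomeomorph ≫ₕ SO3.baseChart

theorem SO3.chart_apply (P R : SO3) : SO3.chart P R = cayInv (P.1ᵀ * R.1) := rfl

theorem SO3.chart_symm_apply (P : SO3) (x : E3) :
    ((SO3.chart P).symm x).1 = P.1 * cayMat x := by
  change ((P⁻¹)⁻¹ * (⟨cayMat x, cayMat_mem x⟩ : SO3)).1 = _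
  rw [inv_inv]
  rfl

theorem SO3.chart_source (P : SO3) : (SO3.chart P).source = {R | 1 + (P.1ᵀ * R.1).trace ≠ 0} := by
  ext R; simp [SO3.chart, SO3.baseChart, so3_inv_coe]

theorem SO3.chart_target (P : SO3) : (SO3.chart P).target = Set.univ := by
  simp [SO3.chart, SO3.baseChart]

/-- The standard smooth structure of `SO₃(ℝ)`: the inclusion into `M₃(ℝ)` is a smooth immersion
and a topological embedding. -/
instance : ChartedSpace E3 SO3 where
  atlas := Set.range SO3.chart
  chartAt := SO3.chart
  mem_chart_source P := by
    rw [SO3.chart_source, Set.mem_ofPred_eq, (so3_eqs P).2.1]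
    norm_num
  chart_mem_atlas P := ⟨P, rfl⟩

instance {n : ℕ∞ω} : IsManifold (𝓡 3) n SO3 := by
  refine isManifold_of_contDiffOn (𝓡 3) n SO3 ?_
  rintro _ _ ⟨P, rfl⟩ ⟨Q, rfl⟩
  have h : ContDiffOn ℝ n (fun x => cayInv (Q.1ᵀ * (P.1 * cayMat x)))
      {x | 1 + (Q.1ᵀ * (P.1 * cayMat x)).trace ≠ 0} :=
    contDiffOn_cayInv.comp (((contDiff_mulMat _).comp
      ((contDiff_mulMat _).comp contDiff_cayMat)).contDiffOn) fun _ h => h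
  refine (h.congr fun x hx => ?_).mono fun x hx => ?_
  · simp [SO3.chart_apply, SO3.chart_symm_apply]
  · have h1 : (SO3.chart P).symm x ∈ (SO3.chart Q).source := by
      simpa [SO3.chart_target] using hx.1
    rw [SO3.chart_source, Set.mem_ofPred_eq, SO3.chart_symm_apply] at h1
    exact h1


/-- The inclusion of `SO₃(ℝ)` into the vector space of real 3×3 matrices. -/
def SO3.incl (R : SO3) : Fin 3 → Fin 3 → ℝ := fun i j => R.1 i j

theorem SO3.contMDiff_incl {n : ℕ∞ω} :
    ContMDiff (𝓡 3) 𝓘(ℝ, Fin 3 → Fin 3 → ℝ) n SO3.incl := by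
  rw [contMDiff_iff]
  refine ⟨continuous_subtype_val, fun P y => ?_⟩
  have h : ContDiff ℝ n (fun x => P.1 * cayMat x) := (contDiff_mulMat _).comp contDiff_cayMat
  refine ContDiffOn.congr (f := fun x => (P.1 * cayMat x : Mat3)) h.contDiffOn fun x _ => ?_
  exact SO3.chart_symm_apply P x

/-- The differential of the inclusion `SO₃(ℝ) ⊂ M₃(ℝ)`, which views a tangent vector as a
matrix. At `1` its values form the space `𝔰𝔬₃(ℝ)` of skew-symmetric matrices. -/
def SO3.tangentMat (P : SO3) (v : TangentSpace (𝓡 3) P) : Mat3 :=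
  Matrix.of (mvfderiv (𝓡 3) SO3.incl P v)

theorem SO3.mfderiv_incl_injective (P : SO3) :
    Function.Injective (mvfderiv (𝓡 3) SO3.incl P) := by
  have hP : (1 + ((P.1ᵀ) * P.1).trace) ≠ 0 := by rw [(so3_eqs P).2.1]; norm_num
  let G : (Fin 3 → Fin 3 → ℝ) → E3 := fun R => cayInv (P.1ᵀ * Matrix.of R)
  have hopen : IsOpen {R : Mat3 | 1 + R.trace ≠ 0} :=
    isOpen_ne_fun (continuous_const.add (continuous_id.matrix_trace)) continuous_const
  have hG : DifferentiableAt ℝ G (SO3.incl P) := by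
    have h1 : DifferentiableAt ℝ cayInv (P.1ᵀ * P.1) :=
      ((contDiffOn_cayInv (n := 1)).contDiffAt (hopen.mem_nhds hP)).differentiableAt (by simp)
    have h2 : DifferentiableAt ℝ (fun R : Mat3 => P.1ᵀ * R) P.1 :=
      ((contDiff_mulMat (n := 1) P.1ᵀ).differentiable (by simp)) _
    exact DifferentiableAt.comp (g := cayInv) (f := fun R : Mat3 => P.1ᵀ * R) (P.1 : Mat3) h1 h2
  have hcomp : (extChartAt (𝓡 3) P : SO3 → E3) = G ∘ SO3.incl := by
    ext1 R
    simp only [mfld_simps]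
    rfl
  have hι : MDifferentiableAt (𝓡 3) 𝓘(ℝ, Fin 3 → Fin 3 → ℝ) SO3.incl P :=
    (SO3.contMDiff_incl (n := 1)).mdifferentiableAt (by simp)
  have hd := mfderiv_comp P hG.mdifferentiableAt hι
  rw [← hcomp] at hd
  have hinv := isInvertible_mfderiv_extChartAt (I := 𝓡 3) (mem_extChartAt_source (I := 𝓡 3) P)
  rw [hd] at hinv
  have := hinv.injective
  exact Function.Injective.of_comp (f := mfderiv 𝓘(ℝ, Fin 3 → Fin 3 → ℝ) 𝓘(ℝ, E3) G (SO3.incl P)) this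

theorem SO3.tangentMat_skew (P : SO3) (v : TangentSpace (𝓡 3) P) :
    (P.1ᵀ * SO3.tangentMat P v)ᵀ = - (P.1ᵀ * SO3.tangentMat P v) := by
  have hι : MDifferentiableAt (𝓡 3) 𝓘(ℝ, Fin 3 → Fin 3 → ℝ) SO3.incl P :=
    (SO3.contMDiff_incl (n := 1)).mdifferentiableAt (by simp)
  let pr : Fin 3 → Fin 3 → (Fin 3 → Fin 3 → ℝ) →L[ℝ] ℝ := fun k i =>
    (ContinuousLinearMap.proj (R := ℝ) (φ := fun _ : Fin 3 => ℝ) i).comp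
      (ContinuousLinearMap.proj (R := ℝ) (φ := fun _ : Fin 3 => (Fin 3 → ℝ)) k)
  have key : ∀ i j, ∑ k, (P.1 k i * SO3.tangentMat P v k j + P.1 k j * SO3.tangentMat P v k i) = 0 := by
    intro i j
    have hN : HasFDerivAt (fun F : Fin 3 → Fin 3 → ℝ => ∑ k, F k i * F k j)
        (∑ k, (SO3.incl P k i • pr k j + SO3.incl P k j • pr k i)) (SO3.incl P) := by
      refine HasFDerivAt.fun_sum fun k _ => ?_
      exact (pr k i).hasFDerivAt.mul (pr k j).hasFDerivAt
    have hc := hN.hasMFDerivAt.comp P hι.hasMFDerivAt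
    have h0 : (fun F : Fin 3 → Fin 3 → ℝ => ∑ k, F k i * F k j) ∘ SO3.incl =
        fun _ => (1 : Mat3) i j := by
      ext1 R
      rw [← (so3_eqs R).2.1]
      simp [Matrix.mul_apply, SO3.incl]
    rw [h0] at hc
    have hu := hasMFDerivAt_unique hc (hasMFDerivAt_const _ _)
    have := congrArg (fun L => L v) hu
    have h2 : (∑ k, (SO3.incl P k i • pr k j + SO3.incl P k j • pr k i))
        (mvfderiv (𝓡 3) SO3.incl P v) = 0 :=
      this
    have h3 : (∑ k, (SO3.incl P k i • pr k j + SO3.incl P k j • pr k i))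
        (mvfderiv (𝓡 3) SO3.incl P v) =
        ∑ k, (SO3.incl P k i • pr k j + SO3.incl P k j • pr k i)
          (mvfderiv (𝓡 3) SO3.incl P v) := sum_apply _ _ _
    exact h3.symm.trans h2
  ext i j
  have := key i j
  simp only [Matrix.transpose_apply, Matrix.neg_apply, Matrix.mul_apply, Fin.sum_univ_three] at this ⊢
  linarith

end SO3

/-- Real 3×3 matrices as a normed vector space. -/
abbrev FMat : Type := Fin 3 → Fin 3 → ℝ

/-- The bilinear form `-(1/8) tr(XY)` on real 3×3 matrices. -/
def traceForm : FMat →L[ℝ] FMat →L[ℝ] ℝ :=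
  LinearMap.toContinuousBilinearMap <|
    ((-(1 / 8 : ℝ)) • ((LinearMap.mul ℝ Mat3).compr₂ (Matrix.traceLinearMap (Fin 3) ℝ ℝ))).compl₁₂
      (Matrix.ofLinearEquiv ℝ).toLinearMap (Matrix.ofLinearEquiv ℝ).toLinearMap

theorem traceForm_apply (X Y : FMat) :
    traceForm X Y = -(1 / 8) * (Matrix.of X * Matrix.of Y).trace := rfl

/-- The map `(P, X) ↦ PᵀX`. -/
def transposeMul : FMat →L[ℝ] FMat →L[ℝ] FMat :=
  LinearMap.toContinuousBilinearMap <|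
    ((LinearMap.mul ℝ Mat3).compr₂ (Matrix.ofLinearEquiv ℝ).symm.toLinearMap).compl₁₂
      ((Matrix.transposeLinearEquiv (Fin 3) (Fin 3) ℝ ℝ).toLinearMap ∘ₗ
        (Matrix.ofLinearEquiv ℝ).toLinearMap) (Matrix.ofLinearEquiv ℝ).toLinearMap

theorem transposeMul_apply (P X : FMat) :
    Matrix.of (transposeMul P X) = (Matrix.of P)ᵀ * Matrix.of X := rfl

theorem neg_trace_mul_self_pos (W : Mat3) (hW : Wᵀ = -W) (h0 : W ≠ 0) :
    0 < -(1 / 8) * (W * W).trace := by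
  have h : ∀ i j, W j i = -W i j := fun i j => congrFun (congrFun hW i) j
  have e : -(1 / 8) * (W * W).trace = 1 / 8 * ∑ i, ∑ j, W i j ^ 2 := by
    rw [Matrix.trace, Finset.mul_sum, Finset.mul_sum]
    refine Finset.sum_congr rfl fun i _ => ?_
    rw [Matrix.diag_apply, Matrix.mul_apply, Finset.mul_sum, Finset.mul_sum]
    refine Finset.sum_congr rfl fun j _ => ?_
    rw [h i j]
    ring
  rw [e]
  refine mul_pos (by norm_num) (lt_of_le_of_ne (by positivity) fun hs => h0 ?_)
  ext i j
  have h1 := (Finset.sum_eq_zero_iff_of_nonneg fun i _ => by positivity).1 hs.symm i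
    (Finset.mem_univ _)
  have h2 := (Finset.sum_eq_zero_iff_of_nonneg fun j _ => by positivity).1 h1 j
    (Finset.mem_univ _)
  simpa using h2

/-- The bi-invariant metric `g⁸` on `SO₃(ℝ)`: at `P`, the tangent vectors `PX` and `PY`, where
`X, Y ∈ 𝔰𝔬₃(ℝ)`, have inner product `-(1/8) tr(XY)`. -/
def g8 : RiemMetric SO3 :=
  pullbackMetric SO3.incl SO3.contMDiff_incl
    (fun P => traceForm.bilinearComp (transposeMul P.incl) (transposeMul P.incl))
    (fun P => contMDiffAt_bilinearComp contMDiffAt_const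
      (transposeMul.contDiff.contMDiff.contMDiffAt.comp P SO3.contMDiff_incl.contMDiffAt))
    (fun P u v => by
      simp only [ContinuousLinearMap.bilinearComp_apply, traceForm_apply]
      rw [Matrix.trace_mul_comm])
    (fun P v hv => by
      refine neg_trace_mul_self_pos (P.1ᵀ * SO3.tangentMat P v) (SO3.tangentMat_skew P v)
        fun h => hv (SO3.mfderiv_incl_injective P ?_)
      have h1 : P.1 * (P.1ᵀ * SO3.tangentMat P v) = SO3.tangentMat P v := by
        rw [← mul_assoc, (so3_eqs P).1, one_mul]
      rw [h, mul_zero] at h1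
      exact h1.symm.trans (map_zero (mvfderiv (𝓡 3) SO3.incl P)).symm)

theorem g8_inner (P : SO3) (u v : TangentSpace (𝓡 3) P) :
    g8.inner P u v = -(1 / 8) *
      ((P⁻¹).1 * SO3.tangentMat P u * ((P⁻¹).1 * SO3.tangentMat P v)).trace := rfl

/-! ### Conjugation by unit quaternions -/

/-- The basis `(i, j, k)` of the space of pure quaternions. -/
def pureBasis : Fin 3 → ℍ[ℝ] := ![⟨0, 1, 0, 0⟩, ⟨0, 0, 1, 0⟩, ⟨0, 0, 0, 1⟩]

/-- The coordinates of a quaternion with respect to `i`, `j`, `k`. -/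
def pureCoord (q : ℍ[ℝ]) : Fin 3 → ℝ := ![q.imI, q.imJ, q.imK]

/-- The matrix, in the basis `(i, j, k)`, of `h ↦ q h q⁻¹` on the pure quaternions: its columns
are the coordinates of `q i q⁻¹`, `q j q⁻¹`, `q k q⁻¹`. -/
def conjMat (q : S3) : Mat3 :=
  Matrix.of fun r c => pureCoord ((q : ℍ[ℝ]) * pureBasis c * (q : ℍ[ℝ])⁻¹) r

theorem S3.normSq_eq (q : S3) :
    q.1.re ^ 2 + q.1.imI ^ 2 + q.1.imJ ^ 2 + q.1.imK ^ 2 = 1 := by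
  rw [← Quaternion.normSq_def', Quaternion.normSq_eq_norm_mul_self]
  simp

theorem S3.inv_eq (q : S3) : (q : ℍ[ℝ])⁻¹ = star q.1 := by
  rw [Quaternion.inv_def, Quaternion.normSq_def', S3.normSq_eq]
  simp

theorem conjMat_eq (q : S3) : conjMat q =
    !![q.1.re ^ 2 + q.1.imI ^ 2 - q.1.imJ ^ 2 - q.1.imK ^ 2,
        2 * (q.1.imI * q.1.imJ - q.1.re * q.1.imK), 2 * (q.1.imI * q.1.imK + q.1.re * q.1.imJ);
      2 * (q.1.imI * q.1.imJ + q.1.re * q.1.imK),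
        q.1.re ^ 2 - q.1.imI ^ 2 + q.1.imJ ^ 2 - q.1.imK ^ 2,
        2 * (q.1.imJ * q.1.imK - q.1.re * q.1.imI);
      2 * (q.1.imI * q.1.imK - q.1.re * q.1.imJ), 2 * (q.1.imJ * q.1.imK + q.1.re * q.1.imI),
        q.1.re ^ 2 - q.1.imI ^ 2 - q.1.imJ ^ 2 + q.1.imK ^ 2] := by
  ext r c
  simp only [conjMat, S3.inv_eq]
  fin_cases r <;> fin_cases c <;> simp [pureBasis, pureCoord] <;> ring

theorem conjMat_mem (q : S3) : conjMat q ∈ Matrix.specialOrthogonalGroup (Fin 3) ℝ := by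
  have h := S3.normSq_eq q
  rw [conjMat_eq]
  generalize q.1.re = a at *
  generalize q.1.imI = b at *
  generalize q.1.imJ = c at *
  generalize q.1.imK = d at *
  rw [Matrix.mem_specialOrthogonalGroup_iff, Matrix.mem_orthogonalGroup_iff]
  constructor
  · ext i j
    fin_cases i <;> fin_cases j <;>
      simp [Matrix.mul_apply, Fin.sum_univ_three] <;> grind
  · rw [Matrix.det_fin_three]
    simp
    grind

/-- The map `B : S³ → SO₃(ℝ)`. -/
def B (q : S3) : SO3 := ⟨conjMat q, conjMat_mem q⟩

end QuatRot

end

/-!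
Everything rests on the formula `B(q) h = q h q̄`. It exhibits `B`, as a map into matrices, as the
restriction to the diagonal of the bilinear map `conjForm`, and it makes `B` multiplicative.

*Differential.* By the product rule, `dB_q(w)` is the matrix of `h ↦ w h q̄ + q h w̄`. Translating
back to the identity by `B(q)⁻¹` turns this into `h ↦ u h - h u` with `u = q̄ w`, which is pure since
`w ⊥ q`; its matrix is twice the cross-product matrix of `u`
(`inv_mul_tangentMat_mfderiv_B`, `conjForm_one_add`). The form `-(1/8) tr` of two such matrices is the
Euclidean inner product of the quaternions, so `B` is a local isometry from the round metric to `g⁸`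
(`g8_mfderiv_B`).

*Diffeomorphism.* The fibres of `B` are the pairs `{q, -q}` (`B_eq_B_iff`). The charts of `SO₃(ℝ)` are
Cayley coordinates, and in the chart around `B p` the map `B` has an explicit smooth section
`x ↦ p · (1 + x₀ i + x₁ j + x₂ k)`, rescaled to norm one (`B_mul_cayQuat`). The four such charts for
`p = 1, i, j, k` cover `SO₃(ℝ)`, so `B` is onto (`surjective_B`), and the sections show that the
inverse of the induced bijection is smooth. No inverse function theorem or connectedness argument is needed.

*Metric.* The projection is a local diffeomorphism, so it is a Riemannian submersion exactly when it
is a local isometry (`isRiemannianSubmersion_proj_iff`). As the projection and its differentials are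
surjective, this determines the metric, and since `B` is a local isometry, the pullback of `g⁸` along
the induced diffeomorphism is such a metric.
-/

noncomputable section

namespace QuatRot

open Filter Topology

/-! ### The projection to the quotient -/

theorem surjective_proj : Function.Surjective proj := Quotient.mk_surjective

theorem proj_eq_proj_iff {p q : S3} : proj p = proj q ↔ p = q ∨ p = -q := by
  constructor
  · intro h
    obtain ⟨⟨g, hg⟩, h⟩ : ∃ g : pmOne, g • q = p := Quotient.exact h
    rcases hg with rfl | rfl
    · exact Or.inl (h.symm.trans (one_mul q))
    · exact Or.inr (h.symm.trans (neg_one_mul q))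
  · rintro (rfl | rfl)
    · rfl
    · exact Quotient.sound ⟨⟨-1, Or.inr rfl⟩, neg_one_mul q⟩

/-- The charts of `S³/{±1}` are charts of `S³` composed with local inverses of the projection, so
near each point the projection has a smooth local section, and is itself smooth at a preimage. -/
theorem exists_contMDiffAt_section (z : S3modPM) :
    ∃ a : S3, proj a = z ∧ ContMDiffAt (𝓡 3) (𝓡 3) ∞ proj a ∧
      ∃ s : S3modPM → S3, ContMDiffAt (𝓡 3) (𝓡 3) ∞ s z ∧
        ∀ᶠ y in 𝓝 z, proj (s y) = y := by
  have hf : IsLocalHomeomorph (Quotient.mk (MulAction.orbitRel pmOne S3)) :=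
    isQuotientCoveringMap_quotientMk_of_properlyDiscontinuousSMul.isCoveringMap
      |>.isLocalHomeomorph
  -- The base point `a` is the representative of `z` chosen in the charted space structure.
  obtain ⟨a, rfl, ha⟩ : ∃ a, proj a = z ∧
      chartAt E3 z = (hf.localInverseAt a).trans (chartAt E3 a) :=
    ⟨_, Quotient.mk_surjective.hasRightInverse.choose_spec z, rfl⟩
  set s := hf.localInverseAt a with hs
  have hsa : s (proj a) = a := hf.localInverseAt_apply_self
  have hsrc : proj a ∈ s.source := hf.apply_self_mem_localInverseAt_source
  have hz := mem_chart_source E3 (proj a)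
  refine ⟨a, rfl, ?_, s, ?_, ?_⟩
  · have h1 : ContMDiffAt (𝓡 3) (𝓡 3) ∞ (chartAt E3 a) a :=
      contMDiffOn_chart.contMDiffAt ((chartAt E3 a).open_source.mem_nhds (mem_chart_source E3 a))
    have ht : chartAt E3 a a ∈ (chartAt E3 (proj a)).target := by
      have := (chartAt E3 (proj a)).map_source hz
      rw [ha, OpenPartialHomeomorph.coe_trans, Function.comp_apply, hsa, ← ha] at this
      exact this
    have h2 : ContMDiffAt (𝓡 3) (𝓡 3) ∞ (chartAt E3 (proj a)).symm (chartAt E3 a a) :=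
      contMDiffOn_chart_symm.contMDiffAt ((chartAt E3 (proj a)).open_target.mem_nhds ht)
    refine (h2.comp a h1).congr_of_eventuallyEq ?_
    filter_upwards [(chartAt E3 a).open_source.mem_nhds (mem_chart_source E3 a)] with y hy
    rw [ha, Function.comp_apply, OpenPartialHomeomorph.trans_symm_eq_symm_trans_symm,
      OpenPartialHomeomorph.coe_trans, Function.comp_apply, (chartAt E3 a).left_inv hy,
      hf.localInverseAt_symm]
    rfl
  · have h1 : ContMDiffAt (𝓡 3) (𝓡 3) ∞ (chartAt E3 (proj a)) (proj a) :=
      contMDiffOn_chart.contMDiffAt ((chartAt E3 (proj a)).open_source.mem_nhds hz)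
    have ht : chartAt E3 (proj a) (proj a) ∈ (chartAt E3 a).target := by
      rw [ha, OpenPartialHomeomorph.coe_trans, Function.comp_apply, hsa]
      exact mem_chart_target E3 a
    have h2 : ContMDiffAt (𝓡 3) (𝓡 3) ∞ (chartAt E3 a).symm (chartAt E3 (proj a) (proj a)) :=
      contMDiffOn_chart_symm.contMDiffAt ((chartAt E3 a).open_target.mem_nhds ht)
    refine (h2.comp (proj a) h1).congr_of_eventuallyEq ?_
    filter_upwards [(chartAt E3 (proj a)).open_source.mem_nhds hz] with y hy
    rw [ha, OpenPartialHomeomorph.trans_source] at hy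
    rw [Function.comp_apply, ha, OpenPartialHomeomorph.coe_trans, Function.comp_apply,
      (chartAt E3 a).left_inv hy.2]
  · filter_upwards [s.open_source.mem_nhds hsrc] with y hy
    exact hf.apply_localInverseAt_of_mem hy

theorem contMDiff_proj : ContMDiff (𝓡 3) (𝓡 3) ∞ proj := by
  intro q
  obtain ⟨a, ha, hp, -⟩ := exists_contMDiffAt_section (proj q)
  rcases proj_eq_proj_iff.1 ha with rfl | rfl
  · exact hp
  · refine (hp.comp q (contMDiff_neg_sphere (E := ℍ[ℝ]) q)).congr_of_eventuallyEq
      (Eventually.of_forall fun y => ?_)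
    exact (proj_eq_proj_iff.2 (Or.inr rfl)).symm

/-- A map out of `S³/{±1}` is smooth if its composition with the projection is. -/
theorem contMDiff_of_comp_proj {N : Type*} [TopologicalSpace N] [ChartedSpace E3 N]
    {f : S3modPM → N} (hf : ContMDiff (𝓡 3) (𝓡 3) ∞ (f ∘ proj)) :
    ContMDiff (𝓡 3) (𝓡 3) ∞ f := by
  intro z
  obtain ⟨a, -, -, s, hs, hps⟩ := exists_contMDiffAt_section z
  refine ((hf (s z)).comp z hs).congr_of_eventuallyEq ?_
  filter_upwards [hps] with y hy
  simp only [Function.comp_apply, hy]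

/-! ### Multiplicativity and smoothness of `B` -/

/-- The bilinear map `(a, b) ↦ (h ↦ pure part of a h b̄)` on quaternions, whose values are matrices
with respect to the basis `(i, j, k)`. Its restriction to the diagonal of `S³ × S³` is `B`. -/
def conjForm : ℍ[ℝ] →L[ℝ] ℍ[ℝ] →L[ℝ] FMat :=
  LinearMap.toContinuousBilinearMap <| LinearMap.mk₂ ℝ
    (fun a b r c => pureCoord (a * pureBasis c * star b) r)
    (fun a a' b => by ext r c; fin_cases r <;> simp [pureCoord, add_mul])
    (fun t a b => by ext r c; fin_cases r <;> simp [pureCoord])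
    (fun a b b' => by ext r c; fin_cases r <;> simp [pureCoord, mul_add])
    (fun t a b => by ext r c; fin_cases r <;> simp [pureCoord])

theorem conjForm_apply (a b : ℍ[ℝ]) (r c : Fin 3) :
    conjForm a b r c = pureCoord (a * pureBasis c * star b) r := rfl

theorem incl_B (q : S3) : SO3.incl (B q) = conjForm q.1 q.1 := by
  ext r c
  simp only [SO3.incl, B, conjMat, Matrix.of_apply, conjForm_apply, S3.inv_eq]

/-- Valid for all `h`, not only pure ones: conjugation by `q` fixes the real line. -/
theorem pureCoord_conj (q : S3) (h : ℍ[ℝ]) :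
    pureCoord (q.1 * h * star q.1) = conjMat q *ᵥ pureCoord h := by
  rw [conjMat_eq]
  ext r
  fin_cases r <;> simp [pureCoord, Matrix.mulVec, dotProduct, Fin.sum_univ_three] <;> ring

theorem conjForm_mul_mul (q : S3) (a b : ℍ[ℝ]) :
    Matrix.of (conjForm (q.1 * a) (q.1 * b)) = (B q).1 * Matrix.of (conjForm a b) := by
  ext r c
  have : q.1 * a * pureBasis c * star (q.1 * b) = q.1 * (a * pureBasis c * star b) * star q.1 := by
    simp only [star_mul, mul_assoc]
  rw [Matrix.of_apply, conjForm_apply, this, pureCoord_conj]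
  rfl

theorem B_mul (p q : S3) : B (p * q) = B p * B q := by
  have h := conjForm_mul_mul p q.1 q.1
  refine Subtype.ext ?_
  have e : ∀ u : S3, (B u).1 = Matrix.of (conjForm u.1 u.1) := fun u => by
    rw [← incl_B]; rfl
  rw [e (p * q)]
  refine h.trans ?_
  rw [← e q]
  rfl

section

attribute [local instance] Matrix.normedAddCommGroup Matrix.normedSpace

/-- `SO₃(ℝ)` is an embedded submanifold of the space of matrices: a map into it is smooth if it is
smooth as a map to matrices. -/
theorem SO3.contMDiff_of_incl_comp {M : Type*} [TopologicalSpace M] [ChartedSpace E3 M]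
    {f : M → SO3} (hf : ContMDiff (𝓡 3) 𝓘(ℝ, FMat) ∞ (SO3.incl ∘ f)) :
    ContMDiff (𝓡 3) (𝓡 3) ∞ f := by
  intro x
  have hfc : Continuous f := continuous_induced_rng.2 hf.continuous
  refine contMDiffAt_iff_target.2 ⟨hfc.continuousAt, ?_⟩
  set P := f x
  have hP : (1 + ((P.1ᵀ) * P.1).trace) ≠ 0 := by rw [(so3_eqs P).2.1]; norm_num
  have hopen : IsOpen {R : Mat3 | 1 + R.trace ≠ 0} :=
    isOpen_ne_fun (continuous_const.add (continuous_id.matrix_trace)) continuous_const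
  have h1 : ContDiffAt ℝ ∞ cayInv (P.1ᵀ * P.1) :=
    contDiffOn_cayInv.contDiffAt (hopen.mem_nhds hP)
  have h2 : ContDiffAt ℝ ∞ (fun R : Mat3 => P.1ᵀ * R) P.1 := (contDiff_mulMat P.1ᵀ).contDiffAt
  have h3 : ContDiffAt ℝ ∞ (fun R : FMat => cayInv (P.1ᵀ * Matrix.of R)) (SO3.incl P) :=
    ContDiffAt.comp (g := cayInv) (f := fun R : Mat3 => P.1ᵀ * R) (P.1 : Mat3) h1 h2
  refine (h3.contMDiffAt.comp x (hf x)).congr_of_eventuallyEq (Eventually.of_forall fun y => ?_)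
  simp only [mfld_simps]
  rfl

end

theorem contMDiff_B : ContMDiff (𝓡 3) (𝓡 3) ∞ B := by
  refine SO3.contMDiff_of_incl_comp ?_
  have h : ContMDiff (𝓡 3) 𝓘(ℝ, ℍ[ℝ]) ∞ (Subtype.val : S3 → ℍ[ℝ]) := contMDiff_coe_sphere
  have hc : ContDiff ℝ ∞ (fun a : ℍ[ℝ] => conjForm a a) :=
    conjForm.contDiff.clm_apply contDiff_id
  exact (hc.contMDiff.comp h).congr incl_B

/-! ### Bijectivity of the induced map -/

theorem B_eq_one_iff {q : S3} : B q = 1 ↔ q = 1 ∨ q = -1 := by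
  constructor
  · intro h
    have h1 : conjMat q = 1 := congrArg Subtype.val h
    have hn := S3.normSq_eq q
    have e0 := congrFun (congrFun h1 0) 0
    have e1 := congrFun (congrFun h1 1) 1
    have e2 := congrFun (congrFun h1 2) 2
    rw [conjMat_eq] at e0 e1 e2
    simp at e0 e1 e2
    -- Subtracting a diagonal entry from `|q|² = 1` shows that two of the squares vanish.
    have hi : q.1.imI = 0 := by nlinarith
    have hj : q.1.imJ = 0 := by nlinarith
    have hk : q.1.imK = 0 := by nlinarith
    have hr : q.1.re = 1 ∨ q.1.re = -1 := by
      rw [hi, hj, hk] at hn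
      refine mul_self_eq_one_iff.1 ?_
      linarith [sq q.1.re]
    refine hr.imp (fun hr => Subtype.ext ?_) (fun hr => Subtype.ext ?_)
    · ext <;> simp [hi, hj, hk, hr]
    · ext <;> simp [hi, hj, hk, hr]
  · rintro (rfl | rfl)
    all_goals
      refine Subtype.ext ?_
      change conjMat _ = 1
      rw [conjMat_eq]
      ext i j
      fin_cases i <;> fin_cases j <;> simp

theorem B_eq_B_iff {p q : S3} : B p = B q ↔ p = q ∨ p = -q := by
  have h1 : B p = B q ↔ B (p * q⁻¹) = 1 := by
    have : B p = B (p * q⁻¹) * B q := by rw [← B_mul, inv_mul_cancel_right]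
    rw [this, mul_eq_right]
  rw [h1, B_eq_one_iff, mul_inv_eq_one, mul_inv_eq_iff_eq_mul, neg_one_mul]

/-- The quaternion `a + b i + c j + d k`. -/
def quat (a b c d : ℝ) : ℍ[ℝ] := ⟨a, b, c, d⟩

@[simp] theorem quat_re (a b c d : ℝ) : (quat a b c d).re = a := rfl
@[simp] theorem quat_imI (a b c d : ℝ) : (quat a b c d).imI = b := rfl
@[simp] theorem quat_imJ (a b c d : ℝ) : (quat a b c d).imJ = c := rfl
@[simp] theorem quat_imK (a b c d : ℝ) : (quat a b c d).imK = d := rfl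

theorem quat_mem_sphere {a b c d : ℝ} (h : a ^ 2 + b ^ 2 + c ^ 2 + d ^ 2 = 1) :
    quat a b c d ∈ Metric.sphere (0 : ℍ[ℝ]) 1 := by
  have h2 : ‖quat a b c d‖ * ‖quat a b c d‖ = 1 := by
    rw [← Quaternion.normSq_eq_norm_mul_self, Quaternion.normSq_def']
    exact h
  rw [mem_sphere_zero_iff_norm]
  nlinarith [norm_nonneg (quat a b c d)]

/-- The unit quaternion obtained by normalizing `1 + x₀ i + x₁ j + x₂ k`. -/
def cayQuat (x : E3) : S3 :=
  ⟨(√(1 + x 0 ^ 2 + x 1 ^ 2 + x 2 ^ 2))⁻¹ • quat 1 (x 0) (x 1) (x 2), by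
    have h : 0 < 1 + x 0 ^ 2 + x 1 ^ 2 + x 2 ^ 2 := by positivity
    have hs := Real.sq_sqrt h.le
    have h0 := (Real.sqrt_pos.2 h).ne'
    refine quat_mem_sphere ?_
    simp only [quat_re, quat_imI, quat_imJ, quat_imK, smul_eq_mul]
    field_simp
    linarith⟩

theorem coe_B_cayQuat (x : E3) : (B (cayQuat x)).1 = cayMat x := by
  have h : 0 < 1 + x 0 ^ 2 + x 1 ^ 2 + x 2 ^ 2 := by positivity
  change conjMat _ = _
  rw [conjMat_eq, cayMat]
  have hs : (√(1 + x 0 ^ 2 + x 1 ^ 2 + x 2 ^ 2))⁻¹ ^ 2 = (1 + x 0 ^ 2 + x 1 ^ 2 + x 2 ^ 2)⁻¹ := by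
    rw [inv_pow, Real.sq_sqrt h.le]
  ext i j
  fin_cases i <;> fin_cases j <;> simp [cayQuat, ← hs] <;> ring

/-- Near `B p`, the map `B` has the explicit section `R ↦ p · c`, where `c` is the unit quaternion
with the same Cayley coordinates as `B(p)⁻¹ R`. -/
theorem B_mul_cayQuat (p : S3) {R : SO3} (hR : R ∈ (SO3.chart (B p)).source) :
    B (p * cayQuat (SO3.chart (B p) R)) = R := by
  refine Subtype.ext ?_
  rw [B_mul, ← (SO3.chart (B p)).left_inv hR, SO3.chart_symm_apply,
    (SO3.chart (B p)).left_inv hR, ← coe_B_cayQuat]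
  rfl

theorem surjective_B : Function.Surjective B := by
  intro R
  -- For `p = 1, i, j, k` the four matrices `B p` add up to zero, so the four numbers
  -- `1 + tr (B(p)ᵀ R)` add up to `4` and cannot all vanish.
  suffices h : ∃ p : S3, 1 + ((B p).1ᵀ * R.1).trace ≠ 0 by
    obtain ⟨p, hp⟩ := h
    exact ⟨_, B_mul_cayQuat p (by rw [SO3.chart_source]; exact hp)⟩
  by_contra! h
  have h0 := h ⟨quat 1 0 0 0, quat_mem_sphere (by norm_num)⟩
  have h1 := h ⟨quat 0 1 0 0, quat_mem_sphere (by norm_num)⟩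
  have h2 := h ⟨quat 0 0 1 0, quat_mem_sphere (by norm_num)⟩
  have h3 := h ⟨quat 0 0 0 1, quat_mem_sphere (by norm_num)⟩
  simp only [B, conjMat_eq, Matrix.trace_fin_three, Matrix.mul_apply, Fin.sum_univ_three]
    at h0 h1 h2 h3
  simp at h0 h1 h2 h3
  linarith

theorem contMDiff_mul_cayQuat (p : S3) : ContMDiff (𝓡 3) (𝓡 3) ∞ fun x => p * cayQuat x := by
  have h1 : ContDiff ℝ ∞ (fun x : E3 => (√(1 + x 0 ^ 2 + x 1 ^ 2 + x 2 ^ 2))⁻¹) := by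
    have hp : ∀ x : E3, 0 < 1 + x 0 ^ 2 + x 1 ^ 2 + x 2 ^ 2 := fun x => by positivity
    have : ContDiff ℝ ∞ (fun x : E3 => 1 + x 0 ^ 2 + x 1 ^ 2 + x 2 ^ 2) := by fun_prop
    exact (this.sqrt fun x => (hp x).ne').inv fun x => (Real.sqrt_pos.2 (hp x)).ne'
  have h2 : ContDiff ℝ ∞ (fun x : E3 => quat 1 (x 0) (x 1) (x 2)) := by
    have e : (fun x : E3 => quat 1 (x 0) (x 1) (x 2)) = fun x =>
        1 + (x 0 • quat 0 1 0 0 + x 1 • quat 0 0 1 0 + x 2 • quat 0 0 0 1) := by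
      ext x <;> simp
    rw [e]
    fun_prop
  have h3 : ContMDiff (𝓡 3) 𝓘(ℝ, ℍ[ℝ]) ∞ fun x : E3 => p.1 * (cayQuat x).1 :=
    ContDiff.contMDiff (contDiff_const.mul (h1.smul h2))
  exact h3.codRestrict_sphere fun x => (p * cayQuat x).2

/-! ### The differential of `B` -/

theorem tangentMat_mfderiv_B (q : S3) (v : TangentSpace (𝓡 3) q) :
    SO3.tangentMat (B q) (mfderiv (𝓡 3) (𝓡 3) B q v) =
      Matrix.of (conjForm (tangentQuat q v) q.1) + Matrix.of (conjForm q.1 (tangentQuat q v)) := by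
  have hB : MDifferentiableAt (𝓡 3) (𝓡 3) B q := (contMDiff_B q).mdifferentiableAt (by simp)
  have hι : MDifferentiableAt (𝓡 3) 𝓘(ℝ, FMat) SO3.incl (B q) :=
    (SO3.contMDiff_incl (n := 1)).mdifferentiableAt (by simp)
  have hv : MDifferentiableAt (𝓡 3) 𝓘(ℝ, ℍ[ℝ]) (Subtype.val : S3 → ℍ[ℝ]) q :=
    (contMDiff_coe_sphere (m := 1) q).mdifferentiableAt (by simp)
  have hd : HasFDerivAt (fun a : ℍ[ℝ] => conjForm a a) (conjForm.precompR ℍ[ℝ] q.1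
      (ContinuousLinearMap.id ℝ _) + conjForm.precompL ℍ[ℝ] (ContinuousLinearMap.id ℝ _) q.1) q.1 :=
    conjForm.hasFDerivAt_of_bilinear (hasFDerivAt_id q.1) (hasFDerivAt_id q.1)
  have h1 := hι.hasMFDerivAt.comp q hB.hasMFDerivAt
  have h2 := hd.hasMFDerivAt.comp q hv.hasMFDerivAt
  have e : SO3.incl ∘ B = (fun a : ℍ[ℝ] => conjForm a a) ∘ Subtype.val := funext incl_B
  rw [e] at h1
  have h := congrArg (fun L => L v) (hasMFDerivAt_unique h1 h2)
  rw [add_comm]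
  exact h

theorem inner_tangentQuat (q : S3) (v : TangentSpace (𝓡 3) q) :
    inner ℝ q.1 (tangentQuat q v) = 0 := by
  have h : tangentQuat q v ∈ (Submodule.span ℝ {q.1})ᗮ := by
    rw [← range_mvfderiv_subtypeVal (n := 3) q]
    exact ⟨v, rfl⟩
  exact Submodule.mem_orthogonal_singleton_iff_inner_right.1 h

theorem exists_tangentQuat_eq {q : S3} {w : ℍ[ℝ]} (hw : inner ℝ q.1 w = 0) :
    ∃ v : TangentSpace (𝓡 3) q, tangentQuat q v = w := by
  have h : w ∈ (Submodule.span ℝ {q.1})ᗮ :=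
    Submodule.mem_orthogonal_singleton_iff_inner_right.2 hw
  rw [← range_mvfderiv_subtypeVal (n := 3) q] at h
  exact h

/-- The infinitesimal rotation `h ↦ u h + h ū = u h - h u` for a pure quaternion `u`. -/
theorem conjForm_one_add {u : ℍ[ℝ]} (hu : u.re = 0) :
    Matrix.of (conjForm u 1) + Matrix.of (conjForm 1 u) =
      (2 : ℝ) • !![0, -u.imK, u.imJ; u.imK, 0, -u.imI; -u.imJ, u.imI, 0] := by
  ext r c
  simp only [Matrix.add_apply, Matrix.of_apply, conjForm_apply]
  rw [show pureBasis = ![quat 0 1 0 0, quat 0 0 1 0, quat 0 0 0 1] from rfl]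
  fin_cases r <;> fin_cases c <;> simp [pureCoord, hu] <;> ring

/-- Left translation to the identity turns `dB` at any point into the differential at `1`, since
`B` is multiplicative. -/
theorem inv_mul_tangentMat_mfderiv_B (q : S3) (v : TangentSpace (𝓡 3) q) :
    ((B q)⁻¹).1 * SO3.tangentMat (B q) (mfderiv (𝓡 3) (𝓡 3) B q v) =
      Matrix.of (conjForm (star q.1 * tangentQuat q v) 1) +
        Matrix.of (conjForm 1 (star q.1 * tangentQuat q v)) := by
  have hq : q.1 * star q.1 = 1 := by
    rw [← S3.inv_eq, mul_inv_cancel₀ (ne_zero_of_mem_unit_sphere q)]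
  have hw : q.1 * (star q.1 * tangentQuat q v) = tangentQuat q v := by
    rw [← mul_assoc, hq, one_mul]
  have h1 := conjForm_mul_mul q (star q.1 * tangentQuat q v) 1
  have h2 := conjForm_mul_mul q 1 (star q.1 * tangentQuat q v)
  rw [hw, mul_one] at h1 h2
  rw [tangentMat_mfderiv_B, h1, h2, ← mul_add, ← mul_assoc, so3_inv_coe, (so3_eqs _).2.1, one_mul]

theorem g8_mfderiv_B (q : S3) (u v : TangentSpace (𝓡 3) q) :
    g8.inner (B q) (mfderiv (𝓡 3) (𝓡 3) B q u) (mfderiv (𝓡 3) (𝓡 3) B q v) =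
      roundMetric.inner q u v := by
  have hre : ∀ w : TangentSpace (𝓡 3) q, (star q.1 * tangentQuat q w).re = 0 := fun w => by
    have h := inner_tangentQuat q w
    rw [Quaternion.inner_def] at h
    simp at h ⊢
    linarith
  have hn := S3.normSq_eq q
  rw [g8_inner, roundMetric_inner, inv_mul_tangentMat_mfderiv_B, inv_mul_tangentMat_mfderiv_B,
    conjForm_one_add (hre u), conjForm_one_add (hre v)]
  have hu := hre u
  have hv := hre v
  generalize tangentQuat q u = a at *
  generalize tangentQuat q v = b at *
  -- Left multiplication by the unit quaternion `q̄` preserves the inner product.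
  have key : inner ℝ a b = (star q.1 * a).re * (star q.1 * b).re +
      (star q.1 * a).imI * (star q.1 * b).imI + (star q.1 * a).imJ * (star q.1 * b).imJ +
      (star q.1 * a).imK * (star q.1 * b).imK := by
    rw [Quaternion.inner_def]
    simp
    linear_combination (-(a.re * b.re + a.imI * b.imI + a.imJ * b.imJ + a.imK * b.imK)) * hn
  rw [key, hu, hv]
  simp only [Matrix.trace_fin_three, Matrix.mul_apply, Fin.sum_univ_three]
  simp
  ring

theorem mfderiv_B_injective (q : S3) : Function.Injective (mfderiv (𝓡 3) (𝓡 3) B q) := by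
  refine (injective_iff_map_eq_zero (mfderiv (𝓡 3) (𝓡 3) B q)).2 fun v hv => ?_
  by_contra h0
  have h := roundMetric.pos q v h0
  rw [← g8_mfderiv_B, hv, map_zero] at h
  exact lt_irrefl _ h

/-! ### The induced diffeomorphism -/

/-- The bijection `S³/{±1} ≃ SO₃(ℝ)` induced by `B`. -/
def quotEquiv : S3modPM ≃ SO3 :=
  Equiv.ofBijective
    (fun z => Quotient.lift B (fun _ _ h => B_eq_B_iff.2 (proj_eq_proj_iff.1 (Quotient.sound h))) z)
    ⟨by
      intro y z h
      obtain ⟨p, rfl⟩ := surjective_proj y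
      obtain ⟨q, rfl⟩ := surjective_proj z
      exact proj_eq_proj_iff.2 (B_eq_B_iff.1 h),
    fun R => (surjective_B R).imp' proj fun _ h => h⟩

theorem quotEquiv_proj (q : S3) : quotEquiv (proj q) = B q := rfl

theorem contMDiff_quotEquiv_symm : ContMDiff (𝓡 3) (𝓡 3) ∞ quotEquiv.symm := by
  intro R
  obtain ⟨p, rfl⟩ := surjective_B R
  have hc : ContMDiffAt (𝓡 3) (𝓡 3) ∞ (chartAt E3 (B p)) (B p) :=
    contMDiffOn_chart.contMDiffAt
      ((chartAt E3 (B p)).open_source.mem_nhds (mem_chart_source E3 (B p)))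
  have h := (contMDiff_proj _).comp (B p) ((contMDiff_mul_cayQuat p _).comp (B p) hc)
  refine h.congr_of_eventuallyEq ?_
  filter_upwards [(chartAt E3 (B p)).open_source.mem_nhds (mem_chart_source E3 (B p))] with R hR
  rw [Equiv.symm_apply_eq]
  exact (B_mul_cayQuat p hR).symm

/-- The diffeomorphism `S³/{±1} ≃ SO₃(ℝ)` induced by `B`. -/
def quotDiffeo : S3modPM ≃ₘ^∞⟮𝓡 3, 𝓡 3⟯ SO3 where
  toEquiv := quotEquiv
  contMDiff_toFun := contMDiff_of_comp_proj contMDiff_B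
  contMDiff_invFun := contMDiff_quotEquiv_symm

theorem quotDiffeo_proj (q : S3) : quotDiffeo (proj q) = B q := rfl

theorem mfderiv_quotDiffeo_proj (q : S3) (v : TangentSpace (𝓡 3) q) :
    mfderiv (𝓡 3) (𝓡 3) quotDiffeo (proj q) (mfderiv (𝓡 3) (𝓡 3) proj q v) =
      mfderiv (𝓡 3) (𝓡 3) B q v := by
  have h := mfderiv_comp q
    ((quotDiffeo.contMDiff (proj q)).mdifferentiableAt (by simp))
    ((contMDiff_proj q).mdifferentiableAt (by simp))
  exact congrArg (fun L => L v) h.symm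

theorem mfderiv_proj_injective (q : S3) : Function.Injective (mfderiv (𝓡 3) (𝓡 3) proj q) := by
  intro u v h
  refine mfderiv_B_injective q ?_
  rw [← mfderiv_quotDiffeo_proj, ← mfderiv_quotDiffeo_proj, h]

theorem mfderiv_proj_surjective (q : S3) : Function.Surjective (mfderiv (𝓡 3) (𝓡 3) proj q) :=
  let L : E3 →L[ℝ] E3 := mfderiv (𝓡 3) (𝓡 3) proj q
  (LinearMap.injective_iff_surjective (f := L.toLinearMap)).1 (mfderiv_proj_injective q)

/-! ### The quotient metric -/

/-- The projection is a local diffeomorphism, so all tangent vectors are horizontal, and it is a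
Riemannian submersion exactly when it is a local isometry. -/
theorem isRiemannianSubmersion_proj_iff {h : RiemMetric S3modPM} :
    IsRiemannianSubmersion roundMetric h proj ↔
      ∀ (q : S3) (u v : TangentSpace (𝓡 3) q),
        h.inner (proj q) (mfderiv (𝓡 3) (𝓡 3) proj q u) (mfderiv (𝓡 3) (𝓡 3) proj q v) =
          roundMetric.inner q u v := by
  constructor
  · intro hs q u v
    have hker : ∀ u w : TangentSpace (𝓡 3) q, mfderiv (𝓡 3) (𝓡 3) proj q w = 0 →
        roundMetric.inner q u w = 0 := fun u w hw => by
      rw [mfderiv_proj_injective q (hw.trans (map_zero (mfderiv (𝓡 3) (𝓡 3) proj q)).symm),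
        map_zero]
    exact ((hs.2 q).2 u v (hker u) (hker v)).symm
  · exact fun hl => ⟨contMDiff_proj, fun q => ⟨mfderiv_proj_surjective q, fun u v _ _ =>
      (hl q u v).symm⟩⟩

/-- The metric on `S³/{±1}` pulled back from `g⁸` along the diffeomorphism induced by `B`. -/
theorem exists_metric_eq_g8_mfderiv : ∃ h : RiemMetric S3modPM,
    ∀ (z : S3modPM) (u v : TangentSpace (𝓡 3) z),
      h.inner z u v = g8.inner (quotDiffeo z) (mfderiv (𝓡 3) (𝓡 3) quotDiffeo z u)
        (mfderiv (𝓡 3) (𝓡 3) quotDiffeo z v) := by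
  have hsm : ContMDiff (𝓡 3) 𝓘(ℝ, FMat) ∞ (SO3.incl ∘ quotDiffeo) :=
    SO3.contMDiff_incl.comp quotDiffeo.contMDiff
  have hd : ∀ (z : S3modPM) (v : TangentSpace (𝓡 3) z),
      mvfderiv (𝓡 3) (SO3.incl ∘ quotDiffeo) z v =
        mvfderiv (𝓡 3) SO3.incl (quotDiffeo z) (mfderiv (𝓡 3) (𝓡 3) quotDiffeo z v) :=
    fun z v => congrArg (fun L => L v) (mfderiv_comp z
      (SO3.contMDiff_incl (n := 1) |>.mdifferentiableAt (by simp))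
      ((quotDiffeo.contMDiff z).mdifferentiableAt (by simp)))
  have hinj : ∀ z, Function.Injective (mfderiv (𝓡 3) (𝓡 3) quotDiffeo z) := by
    intro z u v huv
    obtain ⟨q, rfl⟩ := surjective_proj z
    obtain ⟨u, rfl⟩ := mfderiv_proj_surjective q u
    obtain ⟨v, rfl⟩ := mfderiv_proj_surjective q v
    rw [mfderiv_quotDiffeo_proj, mfderiv_quotDiffeo_proj] at huv
    rw [mfderiv_B_injective q huv]
  have hΦ : ContMDiff (𝓡 3) 𝓘(ℝ, FMat →L[ℝ] FMat →L[ℝ] ℝ) ∞ fun z =>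
      traceForm.bilinearComp (transposeMul (quotDiffeo z).incl)
        (transposeMul (quotDiffeo z).incl) :=
    fun z => contMDiffAt_bilinearComp contMDiffAt_const
      (transposeMul.contDiff.contMDiff.contMDiffAt.comp z hsm.contMDiffAt)
  refine ⟨pullbackMetric (SO3.incl ∘ quotDiffeo) hsm _ hΦ
    (fun z u v => ?_) (fun z v hv => ?_), fun z u v => ?_⟩
  · simp only [ContinuousLinearMap.bilinearComp_apply, traceForm_apply]
    rw [Matrix.trace_mul_comm]
  · rw [hd]
    exact g8.pos (quotDiffeo z) (mfderiv (𝓡 3) (𝓡 3) quotDiffeo z v) fun h =>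
      hv (hinj z (h.trans (map_zero (mfderiv (𝓡 3) (𝓡 3) quotDiffeo z)).symm))
  · rw [pullbackMetric_inner, hd, hd]
    rfl

theorem riemMetric_ext {M : Type*} [TopologicalSpace M] [ChartedSpace E3 M]
    [IsManifold (𝓡 3) ∞ M] {g h : RiemMetric M}
    (e : ∀ (x : M) (u v : TangentSpace (𝓡 3) x), g.inner x u v = h.inner x u v) : g = h := by
  have hi : g.inner = h.inner := by
    funext x
    ext u v
    exact e x u v
  cases g
  cases h
  cases hi
  rfl

end QuatRot

end

theorem mainTheorem3 :
    -- `B` is smooth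
    ContMDiff (𝓡 3) (𝓡 3) ∞ QuatRot.B ∧
    -- the inclusion of `S³` into the quaternions identifies the tangent space of `S³` at `1`
    -- with `ℝ³ = ℝ i ⊕ ℝ j ⊕ ℝ k`
    (∀ v : TangentSpace (𝓡 3) (1 : QuatRot.S3), (QuatRot.tangentQuat 1 v).re = 0) ∧
    (∀ x y z : ℝ, ∃! v : TangentSpace (𝓡 3) (1 : QuatRot.S3),
      QuatRot.tangentQuat 1 v = ⟨0, x, y, z⟩) ∧
    -- the differential of `B` at `1`
    (∀ (x y z : ℝ) (v : TangentSpace (𝓡 3) (1 : QuatRot.S3)),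
      QuatRot.tangentQuat 1 v = ⟨0, x, y, z⟩ →
        QuatRot.SO3.tangentMat (QuatRot.B 1) (mfderiv (𝓡 3) (𝓡 3) QuatRot.B 1 v) =
          (2 : ℝ) • !![0, -z, y; z, 0, -x; -y, x, 0]) ∧
    -- there is exactly one quotient metric on `S³/{±1}`, and `B` induces an isometry for it
    (∃! h : QuatRot.RiemMetric QuatRot.S3modPM,
      QuatRot.IsRiemannianSubmersion QuatRot.roundMetric h QuatRot.proj) ∧
    (∀ h : QuatRot.RiemMetric QuatRot.S3modPM,
      QuatRot.IsRiemannianSubmersion QuatRot.roundMetric h QuatRot.proj →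
        ∃ Bbar : QuatRot.S3modPM ≃ₘ^∞⟮𝓡 3, 𝓡 3⟯ QuatRot.SO3,
          (∀ q : QuatRot.S3, Bbar (QuatRot.proj q) = QuatRot.B q) ∧
          QuatRot.IsRiemannianIsometry h QuatRot.g8 Bbar) := by
  open QuatRot in
  refine ⟨contMDiff_B, fun v => ?_, fun x y z => ?_, fun x y z v hv => ?_, ?_, fun h hs => ?_⟩
  · have h := inner_tangentQuat 1 v
    rw [Quaternion.inner_def] at h
    simpa using h
  · obtain ⟨v, hv⟩ := exists_tangentQuat_eq (q := 1) (w := quat 0 x y z)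
      (by rw [Quaternion.inner_def]; simp)
    exact ⟨v, hv, fun w hw => injective_mvfderiv_subtypeVal_sphere 1 (hw.trans hv.symm)⟩
  · rw [tangentMat_mfderiv_B, hv]
    exact conjForm_one_add (u := quat 0 x y z) rfl
  · obtain ⟨h, hh⟩ := exists_metric_eq_g8_mfderiv
    refine ⟨h, isRiemannianSubmersion_proj_iff.2 fun q u v => ?_, fun k hk => ?_⟩
    · rw [hh, mfderiv_quotDiffeo_proj, mfderiv_quotDiffeo_proj]
      exact g8_mfderiv_B q u v
    · refine riemMetric_ext fun z u v => ?_
      obtain ⟨q, rfl⟩ := surjective_proj z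
      obtain ⟨u, rfl⟩ := mfderiv_proj_surjective q u
      obtain ⟨v, rfl⟩ := mfderiv_proj_surjective q v
      rw [isRiemannianSubmersion_proj_iff.1 hk, hh, mfderiv_quotDiffeo_proj,
        mfderiv_quotDiffeo_proj]
      exact (g8_mfderiv_B q u v).symm
  · refine ⟨quotDiffeo, quotDiffeo_proj, fun z u v => ?_⟩
    obtain ⟨q, rfl⟩ := surjective_proj z
    obtain ⟨u, rfl⟩ := mfderiv_proj_surjective q u
    obtain ⟨v, rfl⟩ := mfderiv_proj_surjective q v
    rw [isRiemannianSubmersion_proj_iff.1 hs, mfderiv_quotDiffeo_proj, mfderiv_quotDiffeo_proj]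
    exact g8_mfderiv_B q u v
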